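/- Let $m \equiv 3 \pmod 4$ and $n \equiv 1 \pmod 4$ be square-free positive integers (they are automatically distinct), let $K = \mathbb{Q}(\sqrt{-m},\sqrt{n})$, and let $\mathcal{O}_K$ be its ring of integers. Let $s(\mathcal{O}_K)$ denote the minimal number $t$ such that $-1$ is a sum of $t$ squares in $\mathcal{O}_K$, and let $g(\mathcal{O}_K)$ denote the smallest positive integer $t$ such that every element of $\mathcal{O}_K$ is a sum of $t$ squares of elements of $\mathcal{O}_K$ (zero being allowed as a summand). If $s(\mathcal{O}_K) = 2$, then $g(\mathcal{O}_K) = 3$. -/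

import Mathlib

open scoped NumberField

namespace IntegralSquares

/-- `a` is a sum of `t` squares of elements of `R` (some of which may be zero). -/
def IsSumOfSquares {R : Type*} [CommRing R] (t : ℕ) (a : R) : Prop :=
  ∃ x : Fin t → R, a = ∑ i, x i ^ 2

/-- `s(R)`: the minimal number of squares required to represent `-1` in `R`
(`⊤` if `-1` is not a sum of squares in `R`). -/
noncomputable def s (R : Type*) [CommRing R] : ℕ∞ :=
  ⨅ (t : ℕ) (_ : IsSumOfSquares t (-1 : R)), (t : ℕ∞)

/-- `g(R)`: the smallest positive integer `t` such that every element of `R` is a sum of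
`t` squares in `R` (`⊤` if there is no such `t`). -/
noncomputable def g (R : Type*) [CommRing R] : ℕ∞ :=
  ⨅ (t : ℕ) (_ : 0 < t ∧ ∀ a : R, IsSumOfSquares t a), (t : ℕ∞)

end IntegralSquares

namespace IntegralSquares

open Polynomial

/-! Both `-m` and `n` are `1` modulo `4`, so `2` is unramified in `K` and its residue fields are
`F₂` or `F₄`; hence `x ^ 4 = x` in `𝓞 K / 2` (`two_dvd_pow_four_sub_self`). The rest uses only this
congruence and `2 ∤ 1`. Upper bound (`isSumOfSquares_three`): writing `-1 = u² + v²` makes `(1, u,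
v)` isotropic, so translating along it changes a sum of three squares linearly, and it suffices to
represent `x` modulo `2`, where every element is a square. Lower bound
(`exists_not_isSumOfSquares_two`): a sum of two squares `1 + 2t` forces `t` to be an Artin-Schreier
value `z² - z` modulo `2`, and not every class is one. -/

/-- Every algebraic integer in the set `S` is congruent to its fourth power modulo `2`. -/
def FourthPowerCongr {K : Type*} [Field K] (S : Set K) : Prop :=
  ∀ x ∈ S, IsIntegral ℤ x → ∃ y : K, IsIntegral ℤ y ∧ x ^ 4 - x = 2 * y

/-! ### The fourth-power congruence modulo `2` for algebraic integers -/

section Field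

variable {K : Type*} [Field K]

/-- A substitute for the automorphism `c ↦ -c`: polynomial evaluation commutes with the formal sign
change, even when `c ∈ F`. -/
theorem exists_aeval_conj (F : Subfield K) {A B c : K} (hA : A ∈ F) (hB : B ∈ F)
    (hc : c ^ 2 ∈ F) (p : ℤ[X]) :
    ∃ U ∈ F, ∃ V ∈ F, aeval (A + B * c) p = U + V * c ∧ aeval (A - B * c) p = U - V * c := by
  induction p using Polynomial.induction_on' with
  | add p q hp hq =>
    obtain ⟨U, hU, V, hV, h1, h2⟩ := hp
    obtain ⟨U', hU', V', hV', h1', h2'⟩ := hq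
    refine ⟨U + U', add_mem hU hU', V + V', add_mem hV hV', ?_, ?_⟩
    · rw [map_add, h1, h1']; ring
    · rw [map_add, h2, h2']; ring
  | monomial k z =>
    induction k with
    | zero =>
      refine ⟨z, intCast_mem F z, 0, zero_mem F, ?_, ?_⟩ <;> simp
    | succ k ih =>
      obtain ⟨U, hU, V, hV, h1, h2⟩ := ih
      refine ⟨U * A + V * B * c ^ 2, add_mem (mul_mem hU hA) (mul_mem (mul_mem hV hB) hc),
        U * B + V * A, add_mem (mul_mem hU hB) (mul_mem hV hA), ?_, ?_⟩
      · rw [← monomial_mul_X, map_mul, h1, aeval_X]; ring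
      · rw [← monomial_mul_X, map_mul, h2, aeval_X]; ring

theorem isIntegral_conj (F : Subfield K) {A B c : K} (hA : A ∈ F) (hB : B ∈ F)
    (hc : c ^ 2 ∈ F) (hcF : c ∉ F) (hx : IsIntegral ℤ (A + B * c)) :
    IsIntegral ℤ (A - B * c) := by
  obtain ⟨p, hp, h0⟩ := hx
  obtain ⟨U, hU, V, hV, h1, h2⟩ := exists_aeval_conj F hA hB hc p
  rw [← aeval_def] at h0
  rw [h0] at h1
  -- As `c ∉ F`, the relation `U + V * c = 0` forces `V = 0`, so the conjugate is a root of the same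
  -- monic polynomial.
  have hV0 : V = 0 := by
    by_contra hne
    apply hcF
    have : c = -U / V := by
      field_simp
      linear_combination -h1
    rw [this]
    exact div_mem (neg_mem hU) hV
  subst hV0
  refine ⟨p, hp, ?_⟩
  rw [← aeval_def, h2]
  linear_combination -h1

theorem isIntegral_half_one_add [CharZero K] {c : K} {k : ℤ} (hc : c ^ 2 = 4 * k + 1) :
    IsIntegral ℤ ((1 + c) / 2) := by
  refine ⟨X ^ 2 - X - C k, by monicity!, ?_⟩
  rw [← aeval_def]
  simp only [map_sub, map_pow, aeval_X, eq_intCast, map_intCast]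
  linear_combination hc / 4

/-- The congruence `x ^ 4 ≡ x` modulo `2` passes from a field to the field obtained by adjoining a
square root of an integer congruent to `1` modulo `4`. -/
theorem FourthPowerCongr.of_quadratic [CharZero K] (F : Subfield K) {S : Set K} {c : K} {k : ℤ}
    (hF : FourthPowerCongr (F : Set K)) (hc : c ^ 2 = 4 * k + 1)
    (hS : ∀ x ∈ S, ∃ A ∈ F, ∃ B ∈ F, x = A + B * c) : FourthPowerCongr S := by
  intro x hxS hx
  obtain ⟨A, hA, B, hB, rfl⟩ := hS x hxS
  by_cases hcF : c ∈ F
  · exact hF _ (add_mem hA (mul_mem hB hcF)) hx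
  have hint (z : ℤ) : IsIntegral ℤ (z : K) := isIntegral_algebraMap (x := z)
  have h2 : IsIntegral ℤ (2 : K) := by exact_mod_cast hint 2
  have hc2 : c ^ 2 ∈ F := by
    rw [hc]; exact_mod_cast intCast_mem F (4 * k + 1)
  have hx' := isIntegral_conj F hA hB hc2 hcF hx
  have hγ := isIntegral_half_one_add hc
  have hγ' := isIntegral_half_one_add (c := -c) (k := k) (by rw [neg_sq, hc])
  set γ := (1 + c) / 2 with hγdef
  have hγ2 : γ ^ 2 = γ + k := by rw [hγdef]; linear_combination hc / 4
  have hdF : ((4 * k + 1 : ℤ) : K) ∈ F := intCast_mem F _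
  -- The traces of `x` and `γ x` are integral. They determine `x` in the basis `1, γ` up to the
  -- discriminant `4 * k + 1` as denominator, which gives `P` and `Q`.
  have hT : IsIntegral ℤ (2 * A) := by
    have h := hx.add hx'
    rwa [show A + B * c + (A - B * c) = 2 * A by ring] at h
  have hTγ : IsIntegral ℤ (A + ((4 * k + 1 : ℤ) : K) * B) := by
    have h := (hγ.mul hx).add (hγ'.mul hx')
    rwa [show γ * (A + B * c) + (1 + -c) / 2 * (A - B * c) = A + ((4 * k + 1 : ℤ) : K) * B by
      push_cast
      rw [hγdef]
      linear_combination B * hc] at h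
  have h2F : (2 : K) ∈ F := by exact_mod_cast intCast_mem F 2
  set P := ((2 * k + 1 : ℤ) : K) * (2 * A) - (A + ((4 * k + 1 : ℤ) : K) * B) with hP
  set Q := 2 * (A + ((4 * k + 1 : ℤ) : K) * B) - 2 * A with hQ
  have hPF : P ∈ F := sub_mem (mul_mem (intCast_mem F _) (mul_mem h2F hA))
    (add_mem hA (mul_mem hdF hB))
  have hQF : Q ∈ F := sub_mem (mul_mem h2F (add_mem hA (mul_mem hdF hB))) (mul_mem h2F hA)
  have hPi : IsIntegral ℤ P := ((hint _).mul hT).sub hTγ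
  have hQi : IsIntegral ℤ Q := (h2.mul hTγ).sub hT
  obtain ⟨y, hy, hPy⟩ := hF P hPF hPi
  obtain ⟨z, hz, hQz⟩ := hF Q hQF hQi
  obtain ⟨l, hl⟩ : ∃ l : ℤ, k + k ^ 2 = 2 * l := by
    obtain ⟨l, hl⟩ := Int.even_mul_succ_self k
    exact ⟨l, by linear_combination hl⟩
  have hl' : (k : K) + k ^ 2 = 2 * l := by exact_mod_cast hl
  set x := A + B * c with hxdef
  have hdx : ((4 * k + 1 : ℤ) : K) * x = P + Q * γ := by
    rw [hP, hQ, hγdef, hxdef]; push_cast; ring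
  have hγ4 : γ ^ 4 = γ + 2 * (k * γ + l) := by
    linear_combination (γ ^ 2 + γ + k) * hγ2 + hγ2 + hl'
  set w := P + Q * γ with hw
  have hwi : IsIntegral ℤ w := hPi.add (hQi.mul hγ)
  -- The middle binomial coefficients `4, 6, 4` are even, so the congruence for `w` reduces to those
  -- for `P`, `Q` and `γ`.
  have hw4 : w ^ 4 - w = 2 * (y + z * γ + Q ^ 4 * (k * γ + l)
      + 2 * P ^ 3 * (Q * γ) + 3 * P ^ 2 * (Q * γ) ^ 2 + 2 * P * (Q * γ) ^ 3) := by
    rw [hw]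
    linear_combination hPy + γ * hQz + Q ^ 4 * hγ4
  have h3 : IsIntegral ℤ (3 : K) := by exact_mod_cast hint 3
  -- The discriminant is odd, so `w ≡ x` modulo `2` and the congruence descends to `x`.
  have hkx : w = x + 2 * (2 * k * x) := by
    rw [← hdx]; push_cast; ring
  have h4 : x ^ 4 - x = 2 * ((y + z * γ + Q ^ 4 * (k * γ + l)
      + 2 * P ^ 3 * (Q * γ) + 3 * P ^ 2 * (Q * γ) ^ 2 + 2 * P * (Q * γ) ^ 3) + 2 * k * x
      - (4 * (2 * k * x) * x ^ 3 + 12 * (2 * k * x) ^ 2 * x ^ 2 + 16 * (2 * k * x) ^ 3 * x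
        + 8 * (2 * k * x) ^ 4)) := by
    rw [hkx] at hw4
    linear_combination hw4
  refine ⟨_, ?_, h4⟩
  have hQγ := hQi.mul hγ
  have hu : IsIntegral ℤ (2 * (k : K) * x) := (h2.mul (hint k)).mul hx
  have h12 : IsIntegral ℤ (12 : K) := by exact_mod_cast hint 12
  have h16 : IsIntegral ℤ (16 : K) := by exact_mod_cast hint 16
  have h8 : IsIntegral ℤ (8 : K) := by exact_mod_cast hint 8
  have h44 : IsIntegral ℤ (4 : K) := by exact_mod_cast hint 4
  exact ((((((hy.add (hz.mul hγ)).add ((hQi.pow 4).mul (((hint k).mul hγ).add (hint l)))).add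
    ((h2.mul (hPi.pow 3)).mul hQγ)).add ((h3.mul (hPi.pow 2)).mul (hQγ.pow 2))).add
    ((h2.mul hPi).mul (hQγ.pow 3))).add hu).sub
    (((((h44.mul hu).mul (hx.pow 3)).add ((h12.mul (hu.pow 2)).mul (hx.pow 2))).add
      ((h16.mul (hu.pow 3)).mul hx)).add (h8.mul (hu.pow 4)))

theorem fourthPowerCongr_bot [CharZero K] :
    FourthPowerCongr ((⊥ : IntermediateField ℚ K).toSubfield : Set K) := by
  intro x hxF hx
  obtain ⟨q, rfl⟩ := IntermediateField.mem_bot.1 hxF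
  have hq : IsIntegral ℤ q :=
    (isIntegral_algebraMap_iff (algebraMap ℚ K).injective).1 hx
  obtain ⟨z, rfl⟩ := IsIntegrallyClosed.isIntegral_iff.1 hq
  obtain ⟨l, hl⟩ : (2 : ℤ) ∣ z ^ 4 - z := by
    rcases Int.even_or_odd' z with ⟨j, rfl | rfl⟩
    · exact ⟨8 * j ^ 4 - j, by ring⟩
    · exact ⟨8 * j ^ 4 + 16 * j ^ 3 + 12 * j ^ 2 + 3 * j, by ring⟩
  refine ⟨l, isIntegral_algebraMap (x := l), ?_⟩
  simp only [algebraMap_int_eq, eq_intCast, map_intCast]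
  exact_mod_cast hl

/-- Elements of `E(c)`, where `c ^ 2 ∈ E`, have the form `A + B c`. -/
theorem exists_eq_add_mul_of_mem_adjoin [CharZero K] (E : IntermediateField ℚ K) {T : Set K} {c : K}
    (hT : ∀ t ∈ T, t ∈ E ∨ t = c) (hc : c ^ 2 ∈ E) (halg : ∀ t ∈ T, IsAlgebraic ℚ t) {x : K}
    (hx : x ∈ IntermediateField.adjoin ℚ T) :
    ∃ A ∈ E, ∃ B ∈ E, x = A + B * c := by
  rw [← IntermediateField.mem_toSubalgebra,
    IntermediateField.adjoin_toSubalgebra_of_isAlgebraic halg] at hx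
  induction hx using Algebra.adjoin_induction with
  | mem t ht =>
    rcases hT t ht with h | rfl
    · exact ⟨t, h, 0, zero_mem E, by ring⟩
    · exact ⟨0, zero_mem E, 1, one_mem E, by ring⟩
  | algebraMap r => exact ⟨algebraMap ℚ K r, E.algebraMap_mem r, 0, zero_mem E, by ring⟩
  | add x y _ _ hx hy =>
    obtain ⟨A, hA, B, hB, rfl⟩ := hx
    obtain ⟨A', hA', B', hB', rfl⟩ := hy
    exact ⟨A + A', add_mem hA hA', B + B', add_mem hB hB', by ring⟩
  | mul x y _ _ hx hy =>
    obtain ⟨A, hA, B, hB, rfl⟩ := hx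
    obtain ⟨A', hA', B', hB', rfl⟩ := hy
    exact ⟨A * A' + B * B' * c ^ 2, add_mem (mul_mem hA hA') (mul_mem (mul_mem hB hB') hc),
      A * B' + B * A', add_mem (mul_mem hA hB') (mul_mem hB hA'), by ring⟩

theorem isAlgebraic_of_sq_eq_intCast [CharZero K] {c : K} {z : ℤ} (hc : c ^ 2 = z) :
    IsAlgebraic ℚ c := by
  refine ⟨X ^ 2 - C (z : ℚ), (monic_X_pow_sub_C _ two_ne_zero).ne_zero, ?_⟩
  simp [hc]

theorem two_dvd_pow_four_sub_self [CharZero K] {a b : K} {k l : ℤ}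
    (ha : a ^ 2 = 4 * k + 1) (hb : b ^ 2 = 4 * l + 1)
    (hK : IntermediateField.adjoin ℚ {a, b} = ⊤) (x : 𝓞 K) : 2 ∣ x ^ 4 - x := by
  have ha' : IsAlgebraic ℚ a :=
    isAlgebraic_of_sq_eq_intCast (z := 4 * k + 1) (by rw [ha]; push_cast; ring)
  have hb' : IsAlgebraic ℚ b :=
    isAlgebraic_of_sq_eq_intCast (z := 4 * l + 1) (by rw [hb]; push_cast; ring)
  have hQa : FourthPowerCongr ((IntermediateField.adjoin ℚ {a}).toSubfield : Set K) := by
    refine fourthPowerCongr_bot.of_quadratic (⊥ : IntermediateField ℚ K).toSubfield ha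
      fun x hx ↦ exists_eq_add_mul_of_mem_adjoin ⊥ (T := {a}) (fun t ht ↦ Or.inr ht) ?_
        (by simpa using ha') hx
    rw [ha]
    exact_mod_cast intCast_mem (⊥ : IntermediateField ℚ K) (4 * k + 1)
  have hall : FourthPowerCongr (Set.univ : Set K) := by
    refine hQa.of_quadratic _ hb fun x _ ↦ exists_eq_add_mul_of_mem_adjoin
      (IntermediateField.adjoin ℚ {a}) (T := {a, b}) ?_ ?_ ?_ (hK ▸ IntermediateField.mem_top)
    · rintro t (rfl | rfl)
      · exact Or.inl (IntermediateField.mem_adjoin_simple_self ℚ t)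
      · exact Or.inr rfl
    · rw [hb]
      exact_mod_cast intCast_mem (IntermediateField.adjoin ℚ {a}) (4 * l + 1)
    · rintro t (rfl | rfl) <;> assumption
  obtain ⟨y, hy, hxy⟩ := hall x trivial x.2
  exact ⟨⟨y, hy⟩, NumberField.RingOfIntegers.ext hxy⟩

theorem not_two_dvd_one [CharZero K] : ¬ (2 : 𝓞 K) ∣ 1 := by
  rintro ⟨y, hy⟩
  have hy' : (y : K) = algebraMap ℚ K (1 / 2) := by
    have h := congrArg (algebraMap (𝓞 K) K) hy
    simp only [map_one, map_mul, map_ofNat] at h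
    simp only [map_div₀, map_one, map_ofNat]
    field_simp
    linear_combination -h
  have hi : IsIntegral ℤ (algebraMap ℚ K (1 / 2)) := hy' ▸ y.2
  obtain ⟨z, hz⟩ := IsIntegrallyClosed.isIntegral_iff.1
    ((isIntegral_algebraMap_iff (algebraMap ℚ K).injective).1 hi)
  have h2 : ((2 * z : ℤ) : ℚ) = (1 : ℤ) := by
    push_cast
    rw [algebraMap_int_eq, eq_intCast] at hz
    rw [hz]; norm_num
  have := Int.cast_injective h2
  omega

end Field

/-! ### Sums of squares when `x ^ 4 ≡ x` modulo `2` -/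

section Ring

variable {R : Type*} [CommRing R]

theorem IsSumOfSquares.mono {t t' : ℕ} (h : t ≤ t') {x : R} (hx : IsSumOfSquares t x) :
    IsSumOfSquares t' x := by
  obtain ⟨j, rfl⟩ := Nat.exists_eq_add_of_le h
  obtain ⟨f, rfl⟩ := hx
  exact ⟨Fin.append f 0, by simp [Fin.sum_univ_add]⟩

/-- The congruence makes `R / 2` reduced, since `x ≡ (x ^ 2) ^ 2`. -/
theorem two_dvd_of_two_dvd_sq (h4 : ∀ x : R, 2 ∣ x ^ 4 - x) {x : R} (hx : 2 ∣ x ^ 2) : 2 ∣ x := by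
  have : 2 ∣ x ^ 2 * x ^ 2 - (x ^ 4 - x) := dvd_sub (hx.mul_right _) (h4 x)
  convert this using 1; ring

/-- If `-1` is a sum of two squares, then the ternary form `X² + Y² + Z²` has the isotropic vector
`(1, u, v)`; translating a suitable vector along it represents any element. -/
theorem isSumOfSquares_three (h4 : ∀ x : R, 2 ∣ x ^ 4 - x) (h : IsSumOfSquares 2 (-1 : R))
    (x : R) : IsSumOfSquares 3 x := by
  obtain ⟨f, hf⟩ := h
  rw [Fin.sum_univ_two] at hf
  set u := f 0
  set v := f 1
  obtain ⟨e, he⟩ : 2 ∣ 1 + u + v := two_dvd_of_two_dvd_sq h4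
    ⟨u + v + u * v, by linear_combination -hf⟩
  obtain ⟨y, hy⟩ := h4 x
  -- The definition of `p` gives `p + (u + v) * q = 1`, so translating `(p, q, q)` by `t * (1, u,
  -- v)` adds exactly `2 * t` to the sum of squares. As `u + v ≡ 1`, this `q` yields `p ≡ x ^ 2`,
  -- whence `p ^ 2 ≡ x ^ 4 ≡ x`.
  set q := x ^ 2 - 1 with hq
  set p := 1 - (u + v) * q with hp
  obtain ⟨t, ht⟩ : 2 ∣ x - (p ^ 2 + q ^ 2 + q ^ 2) := by
    have hpe : p = x ^ 2 - 2 * e * q := by linear_combination -q * he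
    exact ⟨2 * x ^ 2 * e * q - 2 * e ^ 2 * q ^ 2 - q ^ 2 - y, by
      rw [hpe]; linear_combination -hy⟩
  refine ⟨![p + t, q + t * u, q + t * v], ?_⟩
  simp only [Fin.sum_univ_three, Matrix.cons_val_zero, Matrix.cons_val_one, Matrix.cons_val_two,
    Matrix.head_cons, Matrix.tail_cons]
  rw [hp] at ht ⊢
  linear_combination ht + t ^ 2 * hf

/-- A sum of two squares of the form `1 + 2 t` has `t ≡ z ^ 2 - z` modulo `2`. -/
theorem two_dvd_sub_of_isSumOfSquares_two [IsDomain R] [CharZero R]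
    (h4 : ∀ x : R, 2 ∣ x ^ 4 - x) {t : R} (h : IsSumOfSquares 2 (1 + 2 * t)) :
    ∃ z, 2 ∣ t - (z ^ 2 - z) := by
  obtain ⟨f, hf⟩ := h
  rw [Fin.sum_univ_two] at hf
  set x := f 0
  set y := f 1
  obtain ⟨e, he⟩ : 2 ∣ x + y - 1 := two_dvd_of_two_dvd_sq h4
    ⟨t + 1 + x * y - x - y, by linear_combination -hf⟩
  have hy : y = 1 - x + 2 * e := by linear_combination he
  rw [hy] at hf
  refine ⟨x, e ^ 2 + e * (1 - x), mul_left_cancel₀ (two_ne_zero (α := R)) ?_⟩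
  linear_combination hf

theorem exists_not_isSumOfSquares_two [IsDomain R] [CharZero R]
    (h4 : ∀ x : R, 2 ∣ x ^ 4 - x) (h1 : ¬ (2 : R) ∣ 1) :
    ∃ x : R, ¬ IsSumOfSquares 2 x := by
  by_contra! h
  -- Artin-Schreier values are idempotent modulo `2`: `(z ^ 2 - z) ^ 2 ≡ z ^ 4 + z ^ 2 ≡ z ^ 2 - z`.
  -- If every class were such a value, all would be idempotent, so every `z ^ 2 - z` would vanish
  -- and `1` could not be one.
  have hidem (t : R) : 2 ∣ t ^ 2 - t := by
    obtain ⟨z, e, he⟩ := two_dvd_sub_of_isSumOfSquares_two h4 (h (1 + 2 * t))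
    obtain ⟨y, hy⟩ := h4 z
    obtain rfl : t = z ^ 2 - z + 2 * e := by linear_combination he
    exact ⟨y - z ^ 3 + z + 2 * e ^ 2 + 2 * e * (z ^ 2 - z) - e, by linear_combination hy⟩
  obtain ⟨z, hz⟩ := two_dvd_sub_of_isSumOfSquares_two h4 (h (1 + 2 * 1))
  exact h1 (by simpa using dvd_add hz (hidem z))

theorem g_eq_three [IsDomain R] [CharZero R] (h4 : ∀ x : R, 2 ∣ x ^ 4 - x)
    (h1 : ¬ (2 : R) ∣ 1) (hs : s R = 2) : g R = 3 := by
  have hneg : IsSumOfSquares 2 (-1 : R) := by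
    have hlt : s R < 3 := by rw [hs]; norm_num
    simp only [s, iInf_lt_iff] at hlt
    obtain ⟨t, ht, htlt⟩ := hlt
    have : t < 3 := by exact_mod_cast htlt
    exact ht.mono (by omega)
  apply le_antisymm
  · exact iInf₂_le 3 ⟨by norm_num, isSumOfSquares_three h4 hneg⟩
  · refine le_iInf₂ fun t ht ↦ ?_
    obtain ⟨x, hx⟩ := exists_not_isSumOfSquares_two h4 h1
    have : 3 ≤ t := by
      by_contra! hlt
      exact hx ((ht.2 x).mono (by omega))
    exact_mod_cast this

end Ring

end IntegralSquares

theorem corollary1 (m n : ℕ) (hm : m ≡ 3 [MOD 4]) (hn : n ≡ 1 [MOD 4])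
    (hm_sq : Squarefree m) (hn_sq : Squarefree n)
    (K : Type*) [Field K] [CharZero K] (a b : K)
    (ha : a ^ 2 = -(m : K)) (hb : b ^ 2 = (n : K))
    (hK : IntermediateField.adjoin ℚ {a, b} = ⊤)
    (hs : IntegralSquares.s (𝓞 K) = 2) :
    IntegralSquares.g (𝓞 K) = 3 := by
  obtain ⟨k, hk⟩ : ∃ k : ℤ, -(m : ℤ) = 4 * k + 1 :=
    ⟨(-(m : ℤ) - 1) / 4, by unfold Nat.ModEq at hm; omega⟩
  obtain ⟨l, hl⟩ : ∃ l : ℤ, (n : ℤ) = 4 * l + 1 :=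
    ⟨((n : ℤ) - 1) / 4, by unfold Nat.ModEq at hn; omega⟩
  have ha' : a ^ 2 = 4 * k + 1 := by rw [ha]; exact_mod_cast congrArg (Int.cast (R := K)) hk
  have hb' : b ^ 2 = 4 * l + 1 := by rw [hb]; exact_mod_cast congrArg (Int.cast (R := K)) hl
  exact IntegralSquares.g_eq_three
    (IntegralSquares.two_dvd_pow_four_sub_self ha' hb' hK) IntegralSquares.not_two_dvd_one hs
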